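/- Let $X=[0,1]^2\smallsetminus\{(0,0),(1,1)\}$ and let $F:X\to X$ be the map $$F(x,y)=\left(\frac{y(1-x)}{x+y-xy},\ \frac{x(1-y)}{x+y-xy}\right).$$ Put $x_*=\frac{3-\sqrt5}{2}$, let $p_*=(x_*,x_*)$ be its fixed point, and let $$T(x,y)=(u,v)=\left(\frac{x+y-2x_*}{\sqrt2},\ \frac{-x+y}{\sqrt2}\right),\qquad \tilde F=T\circ F\circ T^{-1}\ \text{ on } T(X),$$ so that $T(p_*)=0$. For a fixed point $p$ of a map $f$ of a set $Z$ to itself, let $W^u(p)$ be the set of points of $Z$ that have a backward $f$-orbit in $Z$ converging to $p$, i.e. the $q$ for which there are $q_0=q,q_1,q_2,\dots$ in $Z$ with $f(q_{n+1})=q_n$ for all $n\ge0$ and $q_n\to p$. Then there is a $C^\infty$ function $\varphi:(-1/\sqrt2,1/\sqrt2)\to\mathbb R$ such that, in the $uv$-coordinates, the unstable manifold of $p_*$ under $F$ and the unstable manifold of $0$ under $\tilde F$ are both equal to the graph: $$T\left(W^u(p_*)\right)=W^u(0)=\{(\varphi(v),v):|v|<1/\sqrt2\},$$ and $\varphi$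 has the following properties. (i) $\varphi(0)=\varphi'(0)=0$; $\varphi$ is strictly increasing on $[0,1/\sqrt2)$, and $\varphi(v)\to\frac{-2+\sqrt5}{\sqrt2}$ as $v\uparrow 1/\sqrt2$. (ii) $\varphi$ is even. (iii) Write $S(u,v)=2x_*(2-x_*)+2\sqrt2(1-x_*)u+v^2-u^2$ and $\kappa=\dfrac{1}{\sqrt2\,(1-4x_*+2x_*^2)}$. For every $v$ with $|v|<1/\sqrt2$ one has $S(\varphi(v),v)>0$, $\left|\dfrac{-2v}{S(\varphi(v),v)}\right|<\dfrac1{\sqrt2}$, and $$\varphi(v)=\kappa\left\{(1-x_*)\left(\varphi(v)^2-v^2\right)+\frac{S(\varphi(v),v)}{\sqrt2}\,\varphi\left(\frac{-2v}{S(\varphi(v),v)}\right)\right\}.$$ -/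

import Mathlib

noncomputable section

namespace RSFF

/-- The unstable manifold of a fixed point `p` of a (not necessarily invertible) map `f` on `X`:
the points of `X` that have a backward `f`-orbit inside `X` converging to `p`. -/
def unstableManifold {E : Type*} [TopologicalSpace E] (f : E → E) (X : Set E) (p : E) : Set E :=
  {q | ∃ a : ℕ → E, a 0 = q ∧ (∀ n, a n ∈ X) ∧ (∀ n, f (a (n + 1)) = a n) ∧
    Filter.Tendsto a Filter.atTop (nhds p)}

/-- The domain: the closed unit square without the corners `(0,0)` and `(1,1)`. -/
def X : Set (ℝ × ℝ) :=
  (Set.Icc (0 : ℝ) 1 ×ˢ Set.Icc (0 : ℝ) 1) \ {((0 : ℝ), (0 : ℝ)), ((1 : ℝ), (1 : ℝ))}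

/-- The minimal model map; it is only used on `X`, where the denominator is positive. -/
def F (p : ℝ × ℝ) : ℝ × ℝ :=
  (p.2 * (1 - p.1) / (p.1 + p.2 - p.1 * p.2), p.1 * (1 - p.2) / (p.1 + p.2 - p.1 * p.2))

/-- The common coordinate of the fixed point. -/
def xStar : ℝ := (3 - √5) / 2

/-- The fixed point of `F` in `X`. -/
def pStar : ℝ × ℝ := (xStar, xStar)

/-- The change of variables `(x, y) ↦ (u, v)`. -/
def T (p : ℝ × ℝ) : ℝ × ℝ := ((p.1 + p.2 - 2 * xStar) / √2, (-p.1 + p.2) / √2)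

/-- The inverse change of variables `(u, v) ↦ (x, y)`. -/
def TInv (w : ℝ × ℝ) : ℝ × ℝ := (xStar + (w.1 - w.2) / √2, xStar + (w.1 + w.2) / √2)

/-- The map in the new coordinates, to be considered on `T '' X`. -/
def FTilde : ℝ × ℝ → ℝ × ℝ := T ∘ F ∘ TInv

/-- Twice the denominator `x + y - x y` in the new coordinates. -/
def S (u v : ℝ) : ℝ :=
  2 * xStar * (2 - xStar) + 2 * √2 * (1 - xStar) * u + v ^ 2 - u ^ 2

/-- The constant of the functional equation. -/
def kappa : ℝ := 1 / (√2 * (1 - 4 * xStar + 2 * xStar ^ 2))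

end RSFF

end

/-!
In the coordinates `a = 1 / x - 1`, `b = 1 / y - 1` the open square becomes the positive quadrant
and `F` becomes `(a, b) ↦ ((1 + b) / a, (1 + a) / b)`, with fixed point `(φ, φ)` for the golden
ratio `φ`. The unstable multiplier there is `-φ`, and the exchange of `a` and `b` commutes with the
map. The unstable curve can therefore be parametrized as `t ↦ (ξ t, ξ (-t))`, with the map acting
as `t ↦ -φ t`, exactly when the single function `ξ` satisfies
`ξ (φ t) * ξ (-t) = 1 + ξ t`.

*Smoothness.* The Taylor coefficients of `ξ` are given by a recursion whose divisors grow like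
`φ ^ n`, which yields the elementary bound `abs_coeff_succ_le`; hence `ξ` is analytic near `0`. The
functional equation, read as a formula for `ξ (φ t)`, continues `ξ` to a smooth positive function
on the line (`exists_isSolution`).

*Shape.* The same equation propagates `ξ' > 0` from a neighbourhood of `0` to the line
(`scaling_induction`) and forces `ξ → ∞` and `ξ → 0` at the two ends. So the coordinate `v` along
the curve is a diffeomorphism of the line onto `(-1/√2, 1/√2)`, and the curve is the graph of a
smooth even function of `v`. Its monotonicity is that of `ξ t + ξ (-t)` in `t ≥ 0`, which is
propagated together with that of `ξ t * ξ (-t)` (`IsSolution.add_neg_lt`). The limit of the graph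
function and the functional equation for it are read off from the parametrization.

*The curve is the whole unstable manifold.* A point of the quadrant off the curve is strictly
comparable, in both coordinates, to some point of the curve. The inverse map reverses this order,
and along two comparable backward orbits the ratio of the larger to the smaller product `a * b`
does not decrease, so the two orbits cannot have the same limit (`not_comparable_of_tendsto`).
-/

open Real Filter Topology

namespace GoldenCurve

/-! ### Power series solution of the functional equation near `0` -/

theorem goldenRatio_bounds : 1.6 < goldenRatio ∧ goldenRatio < 1.7 := by
  have h := goldenRatio_sq
  have h1 := one_lt_goldenRatio
  constructor <;> nlinarith

/-- Taylor coefficients at `0` of the solution of `ξ (φ t) * ξ (-t) = 1 + ξ t` with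
`ξ 0 = φ` and `ξ' 0 = 1`, where `φ` is the golden ratio. -/
noncomputable def coeff : ℕ → ℝ
  | 0 => goldenRatio
  | 1 => 1
  | n + 2 => -(∑ k : Fin (n + 1), (coeff (k + 1) * goldenRatio ^ (k.val + 1)) *
      (coeff (n + 1 - k) * (-1) ^ (n + 1 - k.val))) /
        (goldenRatio ^ (n + 3) + (-1) ^ n * goldenRatio - 1)

/-- The linear part of the recursion has no small divisors. -/
theorem pow_le_divisor (n : ℕ) :
    goldenRatio ^ (n + 2) ≤ goldenRatio ^ (n + 3) + (-1) ^ n * goldenRatio - 1 := by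
  have h := goldenRatio_sq
  have hb := goldenRatio_bounds
  have e : goldenRatio ^ (n + 3) - goldenRatio ^ (n + 2) = goldenRatio ^ (n + 1) := by
    have : goldenRatio ^ (n + 3) - goldenRatio ^ (n + 2) =
      goldenRatio ^ (n + 1) * (goldenRatio ^ 2 - goldenRatio) := by ring
    rw [this, h]; ring
  have h1 : (1 : ℝ) ≤ goldenRatio ^ (n + 1) := one_le_pow₀ (by linarith)
  rcases Nat.even_or_odd n with hn | hn
  · rw [hn.neg_one_pow]; linarith
  · rw [hn.neg_one_pow]
    obtain ⟨m, rfl⟩ := hn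
    have h2 : goldenRatio ^ 2 ≤ goldenRatio ^ (2 * m + 1 + 1) :=
      pow_le_pow_right₀ (by linarith) (by omega)
    linarith

theorem divisor_pos (n : ℕ) : 0 < goldenRatio ^ (n + 3) + (-1) ^ n * goldenRatio - 1 :=
  (pow_pos goldenRatio_pos _).trans_le (pow_le_divisor n)

theorem coeff_zero : coeff 0 = goldenRatio := by simp [coeff]

theorem coeff_one : coeff 1 = 1 := by simp [coeff]

theorem coeff_add_two (n : ℕ) :
    coeff (n + 2) * (goldenRatio ^ (n + 3) + (-1) ^ n * goldenRatio - 1) =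
      -∑ k ∈ Finset.range (n + 1), (coeff (k + 1) * goldenRatio ^ (k + 1)) *
        (coeff (n + 1 - k) * (-1) ^ (n + 1 - k)) := by
  rw [coeff, div_mul_cancel₀ _ (divisor_pos n).ne', Finset.sum_range]

/-- The coefficientwise form of the functional equation. -/
theorem sum_antidiagonal_coeff (n : ℕ) :
    ∑ kl ∈ Finset.HasAntidiagonal.antidiagonal n,
      (coeff kl.1 * goldenRatio ^ kl.1) * (coeff kl.2 * (-1) ^ kl.2) =
      coeff n + if n = 0 then 1 else 0 := by
  have h := goldenRatio_sq
  match n with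
  | 0 => simp [coeff_zero]; linarith
  | 1 => simp [Finset.Nat.sum_antidiagonal_succ, coeff_zero, coeff_one]; linarith
  | n + 2 =>
    rw [Finset.Nat.sum_antidiagonal_eq_sum_range_succ
      (fun i j => (coeff i * goldenRatio ^ i) * (coeff j * (-1) ^ j)), Finset.sum_range_succ,
      Finset.sum_range_succ']
    have e : ∑ k ∈ Finset.range (n + 1), (coeff (k + 1) * goldenRatio ^ (k + 1)) *
        (coeff (n + 2 - (k + 1)) * (-1) ^ (n + 2 - (k + 1))) =
        -(coeff (n + 2) * (goldenRatio ^ (n + 3) + (-1) ^ n * goldenRatio - 1)) := by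
      rw [coeff_add_two, neg_neg]
      refine Finset.sum_congr rfl fun k _ => ?_
      rw [show n + 2 - (k + 1) = n + 1 - k by omega]
    rw [e]
    simp [coeff_zero]
    ring

/-- The majorant `φ ^ (n - 1)` reproduces itself because `∑ φ ^ (-j) = φ`. -/
theorem abs_coeff_succ_le (n : ℕ) : |coeff (n + 1)| ≤ goldenRatio ^ n := by
  induction n using Nat.strong_induction_on with
  | _ n ih =>
    have hg := goldenRatio_pos
    match n with
    | 0 => simp [coeff_one]
    | n + 1 =>
      have hsum : ∀ n : ℕ, ∑ k ∈ Finset.range (n + 1), goldenRatio ^ k ≤ goldenRatio ^ (n + 2) := by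
        intro n
        induction n with
        | zero => simp [goldenRatio_sq, hg.le]
        | succ n ihn =>
          rw [Finset.sum_range_succ]
          have : goldenRatio ^ (n + 1 + 2) = goldenRatio ^ (n + 2) + goldenRatio ^ (n + 1) := by
            rw [pow_add _ (n + 1), goldenRatio_sq]; ring
          linarith
      have hD := pow_le_divisor n
      have hD0 := divisor_pos n
      have key : |coeff (n + 2)| * goldenRatio ^ (n + 2) ≤
          goldenRatio ^ (n + 1) * goldenRatio ^ (n + 2) := by
        calc |coeff (n + 2)| * goldenRatio ^ (n + 2)
            ≤ |coeff (n + 2)| * (goldenRatio ^ (n + 3) + (-1) ^ n * goldenRatio - 1) := by gcongr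
          _ = |∑ k ∈ Finset.range (n + 1), (coeff (k + 1) * goldenRatio ^ (k + 1)) *
                (coeff (n + 1 - k) * (-1) ^ (n + 1 - k))| := by
              rw [← abs_neg (∑ k ∈ _, _), ← coeff_add_two, abs_mul, abs_of_pos hD0]
          _ ≤ ∑ k ∈ Finset.range (n + 1), goldenRatio ^ (n + 1) * goldenRatio ^ k := by
              refine (Finset.abs_sum_le_sum_abs _ _).trans (Finset.sum_le_sum fun k hk => ?_)
              have hk' : k < n + 1 := Finset.mem_range.1 hk
              rw [abs_mul, abs_mul, abs_mul, abs_pow, abs_pow, abs_neg, abs_one, one_pow, mul_one,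
                abs_of_pos hg]
              have h1 := ih k (by omega)
              have h2 := ih (n - k) (by omega)
              rw [show n - k + 1 = n + 1 - k by omega] at h2
              calc |coeff (k + 1)| * goldenRatio ^ (k + 1) * |coeff (n + 1 - k)|
                  ≤ goldenRatio ^ k * goldenRatio ^ (k + 1) * goldenRatio ^ (n - k) := by gcongr
                _ = goldenRatio ^ (n + 1) * goldenRatio ^ k := by
                    rw [← pow_add, ← pow_add, ← pow_add]; congr 1; omega
          _ = goldenRatio ^ (n + 1) * ∑ k ∈ Finset.range (n + 1), goldenRatio ^ k := by
              rw [Finset.mul_sum]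
          _ ≤ _ := by gcongr; exact hsum n
      exact le_of_mul_le_mul_right key (pow_pos hg _)

theorem abs_coeff_le (n : ℕ) : |coeff n| ≤ 2 * goldenRatio ^ n := by
  have hb := goldenRatio_bounds
  cases n with
  | zero => rw [coeff_zero, abs_of_pos goldenRatio_pos]; linarith
  | succ n =>
    refine (abs_coeff_succ_le n).trans ?_
    have := pow_pos goldenRatio_pos n
    rw [pow_succ]; nlinarith

/-- The local solution of the functional equation, as the sum of its Taylor series. -/
noncomputable def localSol (t : ℝ) : ℝ := ∑' n, coeff n * t ^ n

theorem summable_localSol {t : ℝ} (ht : |t| * goldenRatio < 1) :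
    Summable fun n => ‖coeff n * t ^ n‖ := by
  refine Summable.of_nonneg_of_le (fun _ => norm_nonneg _) (fun n => ?_)
    ((summable_geometric_of_lt_one (mul_nonneg (abs_nonneg t) goldenRatio_pos.le) ht).mul_left 2)
  rw [norm_eq_abs, abs_mul, abs_pow, mul_pow]
  have := mul_le_mul_of_nonneg_right (abs_coeff_le n) (pow_nonneg (abs_nonneg t) n)
  linarith

theorem localSol_equation {t : ℝ} (ht : |t| * goldenRatio ^ 2 < 1) :
    localSol (goldenRatio * t) * localSol (-t) = 1 + localSol t := by
  have hb := goldenRatio_bounds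
  have ht0 : |t| * goldenRatio < 1 := by
    refine lt_of_le_of_lt ?_ ht
    rw [pow_two, ← mul_assoc]
    exact le_mul_of_one_le_right (mul_nonneg (abs_nonneg t) goldenRatio_pos.le) (by linarith)
  have h1 := summable_localSol (t := goldenRatio * t) (by
    rw [abs_mul, abs_of_pos goldenRatio_pos]; linarith [ht])
  have h2 := summable_localSol (t := -t) (by rwa [abs_neg])
  have h3 := (summable_localSol ht0).of_norm
  rw [localSol, localSol, tsum_mul_tsum_eq_tsum_sum_antidiagonal_of_summable_norm h1 h2]
  have e : ∀ n, ∑ kl ∈ Finset.HasAntidiagonal.antidiagonal n,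
      coeff kl.1 * (goldenRatio * t) ^ kl.1 * (coeff kl.2 * (-t) ^ kl.2) = (if n = 0 then 1 else 0) + coeff n * t ^ n := by
    intro n
    have : ∑ kl ∈ Finset.HasAntidiagonal.antidiagonal n, coeff kl.1 * (goldenRatio * t) ^ kl.1 *
      (coeff kl.2 * (-t) ^ kl.2) = (∑ kl ∈ Finset.HasAntidiagonal.antidiagonal n,
        (coeff kl.1 * goldenRatio ^ kl.1) * (coeff kl.2 * (-1) ^ kl.2)) * t ^ n := by
      rw [Finset.sum_mul]
      refine Finset.sum_congr rfl fun kl hkl => ?_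
      rw [← Finset.HasAntidiagonal.mem_antidiagonal.1 hkl, mul_pow, neg_pow t, pow_add]; ring
    rw [this, sum_antidiagonal_coeff]
    by_cases hn : n = 0
    · simp [hn, add_comm]
    · simp [hn]
  simp_rw [e]
  rw [Summable.tsum_add (summable_of_ne_finset_zero (s := {0}) (by intro b hb; simpa using hb)) h3]
  simp [localSol]

theorem localSol_hasFPowerSeriesAt :
    HasFPowerSeriesAt localSol (FormalMultilinearSeries.ofScalars ℝ coeff) 0 := by
  have hr : ((Real.toNNReal goldenRatio⁻¹ : NNReal) : ENNReal) ≤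
      (FormalMultilinearSeries.ofScalars ℝ coeff).radius := by
    refine FormalMultilinearSeries.le_radius_of_bound _ 2 fun n => ?_
    rw [FormalMultilinearSeries.ofScalars_norm, norm_eq_abs,
      Real.coe_toNNReal _ (inv_nonneg.2 goldenRatio_pos.le)]
    have h := mul_le_mul_of_nonneg_right (abs_coeff_le n)
      (pow_nonneg (inv_nonneg.2 goldenRatio_pos.le) n)
    refine h.trans_eq ?_
    rw [mul_assoc, ← mul_pow, mul_inv_cancel₀ goldenRatio_ne_zero, one_pow, mul_one]
  have hpos : 0 < (FormalMultilinearSeries.ofScalars ℝ coeff).radius := by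
    refine lt_of_lt_of_le ?_ hr
    rw [ENNReal.coe_pos, Real.toNNReal_pos]
    exact inv_pos.2 goldenRatio_pos
  have h := (FormalMultilinearSeries.ofScalars ℝ coeff).hasFPowerSeriesOnBall hpos
  have e : (FormalMultilinearSeries.ofScalars ℝ coeff).sum = localSol := by
    ext t
    change FormalMultilinearSeries.ofScalarsSum coeff t = _
    rw [FormalMultilinearSeries.ofScalars_sum_eq]
    simp [localSol]
  rw [e] at h
  exact h.hasFPowerSeriesAt

theorem localSol_zero : localSol 0 = goldenRatio := by
  have := localSol_hasFPowerSeriesAt.coeff_zero (fun _ => 0)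
  rw [← this]; simp [FormalMultilinearSeries.ofScalars, coeff_zero]

theorem hasDerivAt_localSol_zero : HasDerivAt localSol 1 0 := by
  have := localSol_hasFPowerSeriesAt.hasDerivAt
  simpa [FormalMultilinearSeries.ofScalars, coeff_one] using this

/-! ### Continuation to the whole line -/

/-- A smooth positive solution of `ξ (φ t) * ξ (-t) = 1 + ξ t` on the whole line. The curve
`t ↦ (ξ t, ξ (-t))` is then mapped to itself by `(a, b) ↦ ((1 + b) / a, (1 + a) / b)`, which
acts on the parameter as multiplication by `-φ`. -/
structure IsSolution (ξ : ℝ → ℝ) : Prop where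
  contDiff : ContDiff ℝ ((⊤ : ℕ∞) : WithTop ℕ∞) ξ
  pos : ∀ t, 0 < ξ t
  equation : ∀ t, ξ (goldenRatio * t) * ξ (-t) = 1 + ξ t
  zero : ξ 0 = goldenRatio
  hasDerivAt_zero : HasDerivAt ξ 1 0

/-- `localSol` continued by `n` applications of the functional equation. -/
noncomputable def extend : ℕ → ℝ → ℝ
  | 0 => localSol
  | n + 1 => fun t => (1 + extend n (t / goldenRatio)) / extend n (-(t / goldenRatio))

theorem exists_isSolution : ∃ ξ, IsSolution ξ := by
  have hg := goldenRatio_pos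
  have hb := goldenRatio_bounds
  have han : AnalyticAt ℝ localSol 0 := localSol_hasFPowerSeriesAt.analyticAt
  have hev : ∀ᶠ t in 𝓝 (0 : ℝ), AnalyticAt ℝ localSol t ∧ 0 < localSol t ∧
      |t| * goldenRatio < 1 := by
    refine han.eventually_analyticAt.and (Eventually.and ?_ ?_)
    · exact han.continuousAt.eventually (lt_mem_nhds (by rw [localSol_zero]; exact hg))
    · have : ContinuousAt (fun t : ℝ => |t| * goldenRatio) 0 := by fun_prop
      exact this.eventually (gt_mem_nhds (by simp))
  obtain ⟨ε, hε, hball⟩ := Metric.eventually_nhds_iff.1 hev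
  replace hball : ∀ t : ℝ, |t| < ε → AnalyticAt ℝ localSol t ∧ 0 < localSol t ∧
      |t| * goldenRatio < 1 := fun t ht => hball (by simpa [dist_eq] using ht)
  have scale : ∀ (t : ℝ) n, |t| < ε * goldenRatio ^ (n + 1) →
      |t / goldenRatio| < ε * goldenRatio ^ n := by
    intro t n ht
    rw [abs_div, abs_of_pos hg, div_lt_iff₀ hg]
    rw [pow_succ] at ht; linarith
  have main : ∀ n t, |t| < ε * goldenRatio ^ n → extend (n + 1) t = extend n t ∧
      ContDiffAt ℝ ((⊤ : ℕ∞) : WithTop ℕ∞) (extend n) t ∧ 0 < extend n t := by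
    intro n
    induction n with
    | zero =>
      intro t ht
      simp only [pow_zero, mul_one] at ht
      obtain ⟨h1, h2, h3⟩ := hball t ht
      refine ⟨?_, h1.contDiffAt, h2⟩
      have ht' : |-(t / goldenRatio)| < ε := by
        rw [abs_neg, abs_div, abs_of_pos hg, div_lt_iff₀ hg]
        nlinarith
      have h4 := (hball _ ht').2.1
      have h5 := localSol_equation (t := t / goldenRatio) (by
        rw [abs_div, abs_of_pos hg, pow_two, ← mul_assoc, div_mul_cancel₀ _ hg.ne']
        exact h3)
      rw [mul_div_cancel₀ _ hg.ne'] at h5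
      simp only [extend]
      rw [← h5, mul_div_cancel_right₀ _ h4.ne']
    | succ n ih =>
      intro t ht
      have h1 := scale t n ht
      obtain ⟨e1, c1, p1⟩ := ih _ h1
      obtain ⟨e2, c2, p2⟩ := ih (-(t / goldenRatio)) (by rwa [abs_neg])
      refine ⟨?_, ?_, ?_⟩
      · change (1 + extend (n + 1) (t / goldenRatio)) / extend (n + 1) (-(t / goldenRatio)) =
          (1 + extend n (t / goldenRatio)) / extend n (-(t / goldenRatio))
        rw [e1, e2]
      · change ContDiffAt ℝ _
          (fun t => (1 + extend n (t / goldenRatio)) / extend n (-(t / goldenRatio))) t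
        refine ContDiffAt.div (contDiffAt_const.add ?_) ?_ p2.ne'
        · exact c1.comp t (by fun_prop)
        · exact c2.comp t (f := fun t => -(t / goldenRatio)) (by fun_prop)
      · change 0 < (1 + extend n (t / goldenRatio)) / extend n (-(t / goldenRatio))
        positivity
  have mono : ∀ n m (t : ℝ), n ≤ m → |t| < ε * goldenRatio ^ n → |t| < ε * goldenRatio ^ m :=
    fun n m t hnm ht => ht.trans_le (mul_le_mul_of_nonneg_left
      (pow_le_pow_right₀ (by linarith) hnm) hε.le)
  have stable : ∀ n m t, n ≤ m → |t| < ε * goldenRatio ^ n → extend m t = extend n t := by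
    intro n m t hnm ht
    induction m, hnm using Nat.le_induction with
    | base => rfl
    | succ m hnm ihm => rw [(main m t (mono n m t hnm ht)).1, ihm]
  have hex : ∀ t : ℝ, ∃ n : ℕ, |t| < ε * goldenRatio ^ n := by
    intro t
    obtain ⟨n, hn⟩ := pow_unbounded_of_one_lt (|t| / ε) one_lt_goldenRatio
    exact ⟨n, by rwa [div_lt_iff₀' hε] at hn⟩
  choose N hN using hex
  have heq : ∀ n t, |t| < ε * goldenRatio ^ n → extend (N t) t = extend n t := by
    intro n t ht
    rcases le_total n (N t) with h | h
    · exact stable _ _ _ h ht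
    · exact (stable _ _ _ h (hN t)).symm
  have hnhds : ∀ n t, |t| < ε * goldenRatio ^ n →
      (fun t => extend (N t) t) =ᶠ[𝓝 t] extend n := by
    intro n t ht
    filter_upwards [continuous_abs.continuousAt.eventually (gt_mem_nhds ht)] with s hs
    exact heq n s hs
  refine ⟨fun t => extend (N t) t, ?_, ?_, ?_, ?_, ?_⟩
  · exact contDiff_iff_contDiffAt.2 fun t =>
      (main _ t (hN t)).2.1.congr_of_eventuallyEq (hnhds _ t (hN t))
  · exact fun t => (main _ t (hN t)).2.2
  · intro t
    have h1 : |goldenRatio * t| < ε * goldenRatio ^ (N t + 1) := by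
      rw [abs_mul, abs_of_pos hg, pow_succ]
      nlinarith [hN t]
    have h2 : |-t| < ε * goldenRatio ^ N t := by rw [abs_neg]; exact hN t
    change extend _ _ * extend _ _ = 1 + extend _ _
    rw [heq _ _ h1, heq _ _ h2]
    simp only [extend]
    rw [mul_div_cancel_left₀ _ hg.ne', div_mul_cancel₀ _ (main _ _ h2).2.2.ne']
  · rw [heq 0 0 (by simpa using hε)]; exact localSol_zero
  · exact hasDerivAt_localSol_zero.congr_of_eventuallyEq (hnhds 0 0 (by simpa using hε))

/-! ### Monotonicity and limits of a solution -/

/-- A property that holds near `0` and is inherited by `φ t` from `t` and `-t` holds on the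
whole line. -/
theorem scaling_induction {p : ℝ → Prop} (h0 : ∀ᶠ t in 𝓝 (0 : ℝ), p t)
    (hs : ∀ t, p t → p (-t) → p (goldenRatio * t)) (t : ℝ) : p t := by
  have hg := goldenRatio_pos
  obtain ⟨ε, hε, hball⟩ := Metric.eventually_nhds_iff.1 h0
  have main : ∀ n : ℕ, ∀ t : ℝ, |t| < ε * goldenRatio ^ n → p t := by
    intro n
    induction n with
    | zero => intro t ht; exact hball (by simpa [dist_eq] using ht)
    | succ n ih =>
      intro t ht
      have h : |t / goldenRatio| < ε * goldenRatio ^ n := by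
        rw [abs_div, abs_of_pos hg, div_lt_iff₀ hg]
        rw [pow_succ] at ht; linarith
      have := hs _ (ih _ h) (ih _ (by rwa [abs_neg]))
      rwa [mul_div_cancel₀ _ hg.ne'] at this
  obtain ⟨n, hn⟩ := pow_unbounded_of_one_lt (|t| / ε) one_lt_goldenRatio
  exact main n t (by rwa [div_lt_iff₀' hε] at hn)

theorem exists_strictMonoOn_of_second_deriv_pos {f f' : ℝ → ℝ} {d : ℝ}
    (hf : ∀ t, HasDerivAt f (f' t) t) (h0 : f' 0 = 0) (hf' : HasDerivAt f' d 0) (hd : 0 < d) :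
    ∃ ε > 0, StrictMonoOn f (Set.Icc 0 ε) := by
  have h := hasDerivAt_iff_tendsto_slope.1 hf'
  have h1 := h.eventually (lt_mem_nhds hd)
  rw [eventually_nhdsWithin_iff, Metric.eventually_nhds_iff] at h1
  obtain ⟨ε, hε, hb⟩ := h1
  refine ⟨ε / 2, by linarith, strictMonoOn_of_deriv_pos (convex_Icc _ _)
    (fun t _ => (hf t).continuousAt.continuousWithinAt) fun t ht => ?_⟩
  rw [interior_Icc] at ht
  have h2 := hb (y := t) (by rw [dist_eq, sub_zero, abs_of_pos ht.1]; linarith [ht.2])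
    (by simpa using ht.1.ne')
  rw [slope_def_field, h0, sub_zero, sub_zero] at h2
  rw [(hf t).deriv]
  exact (div_pos_iff_of_pos_right ht.1).1 h2

namespace IsSolution

variable {ξ : ℝ → ℝ}

theorem hasDerivAt (h : IsSolution ξ) (t : ℝ) : HasDerivAt ξ (deriv ξ t) t :=
  (h.contDiff.differentiable (by simp) t).hasDerivAt

theorem contDiff_deriv (h : IsSolution ξ) : ContDiff ℝ ((⊤ : ℕ∞) : WithTop ℕ∞) (deriv ξ) :=
  ((contDiff_infty_iff_deriv (f := ξ)).1 h.contDiff).2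

theorem hasDerivAt_neg (h : IsSolution ξ) (t : ℝ) :
    HasDerivAt (fun t => ξ (-t)) (-deriv ξ (-t)) t := by
  have := HasDerivAt.comp (h₂ := ξ) (h := fun t => -t) t (h.hasDerivAt (-t))
    (_root_.hasDerivAt_neg t)
  rwa [mul_neg_one] at this

theorem deriv_zero (h : IsSolution ξ) : deriv ξ 0 = 1 := h.hasDerivAt_zero.deriv

/-- The functional equation, differentiated once. -/
theorem deriv_equation (h : IsSolution ξ) (t : ℝ) :
    goldenRatio * deriv ξ (goldenRatio * t) * ξ (-t) - ξ (goldenRatio * t) * deriv ξ (-t) =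
      deriv ξ t := by
  have h1 : HasDerivAt (fun t => ξ (goldenRatio * t))
      (deriv ξ (goldenRatio * t) * (goldenRatio * 1)) t :=
    (h.hasDerivAt _).comp t ((hasDerivAt_id t).const_mul goldenRatio)
  have h2 := h1.mul (h.hasDerivAt_neg t)
  have h3 := (h.hasDerivAt t).const_add 1
  have e : (fun t => ξ (goldenRatio * t)) * (fun t => ξ (-t)) = fun t => 1 + ξ t :=
    funext h.equation
  rw [e] at h2
  have := h2.unique h3
  linarith

theorem hasDerivAt_deriv_zero (h : IsSolution ξ) : HasDerivAt (deriv ξ) (2 / 3) 0 := by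
  have hd : HasDerivAt (deriv ξ) (deriv (deriv ξ) 0) 0 :=
    (h.contDiff_deriv.differentiable (by simp) 0).hasDerivAt
  set d := deriv (deriv ξ) 0
  have hl : HasDerivAt (fun t : ℝ => goldenRatio * t) (goldenRatio * 1) 0 :=
    (hasDerivAt_id 0).const_mul goldenRatio
  have a1 : HasDerivAt (fun t => ξ (goldenRatio * t)) (1 * (goldenRatio * 1)) 0 :=
    HasDerivAt.comp (h₂ := ξ) (h := fun t => goldenRatio * t) 0
      (by simpa using h.hasDerivAt_zero) hl
  have a2 : HasDerivAt (fun t => deriv ξ (goldenRatio * t)) (d * (goldenRatio * 1)) 0 :=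
    HasDerivAt.comp (h₂ := deriv ξ) (h := fun t => goldenRatio * t) 0 (by simpa using hd) hl
  have a3 : HasDerivAt (fun t => ξ (-t)) (1 * -1) 0 :=
    HasDerivAt.comp (h₂ := ξ) (h := fun t => -t) 0
      (by simpa using h.hasDerivAt_zero) (_root_.hasDerivAt_neg 0)
  have a4 : HasDerivAt (fun t => deriv ξ (-t)) (d * -1) 0 :=
    HasDerivAt.comp (h₂ := deriv ξ) (h := fun t => -t) 0 (by simpa using hd)
      (_root_.hasDerivAt_neg 0)
  have h1 := (((a2.const_mul goldenRatio).mul a3).sub (a1.mul a4))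
  have e : ((fun t => goldenRatio * deriv ξ (goldenRatio * t)) * (fun t => ξ (-t)) -
      (fun t => ξ (goldenRatio * t)) * fun t => deriv ξ (-t)) = deriv ξ :=
    funext h.deriv_equation
  rw [e] at h1
  have h2 := h1.unique hd
  simp only [mul_zero, neg_zero, h.zero, h.deriv_zero] at h2
  have hsq := goldenRatio_sq
  have h3 : goldenRatio * (3 * d - 2) = 0 := by
    linear_combination h2 - d * (goldenRatio + 1) * hsq
  have h4 : 3 * d - 2 = 0 := (mul_eq_zero.1 h3).resolve_left goldenRatio_ne_zero
  have : d = 2 / 3 := by linarith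
  rwa [this] at hd

theorem deriv_pos (h : IsSolution ξ) : ∀ t, 0 < deriv ξ t := by
  have hg := goldenRatio_pos
  refine scaling_induction ?_ fun t h1 h2 => ?_
  · refine h.contDiff_deriv.continuous.continuousAt.eventually (lt_mem_nhds ?_)
    rw [h.deriv_zero]; exact one_pos
  · have e := h.deriv_equation t
    have p1 := h.pos (-t)
    have p2 := mul_pos (h.pos (goldenRatio * t)) h2
    have : 0 < (goldenRatio * ξ (-t)) * deriv ξ (goldenRatio * t) := by linarith
    exact (mul_pos_iff_of_pos_left (mul_pos hg p1)).1 this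

theorem strictMono (h : IsSolution ξ) : StrictMono ξ :=
  strictMono_of_deriv_pos h.deriv_pos

theorem tendsto_goldenRatio_mul_atTop : Tendsto (fun t => goldenRatio * t) atTop atTop :=
  tendsto_id.const_mul_atTop goldenRatio_pos

theorem exists_tendsto_atBot (h : IsSolution ξ) : ∃ l, Tendsto ξ atBot (𝓝 l) :=
  ⟨_, tendsto_atBot_ciInf h.strictMono.monotone ⟨0, by rintro _ ⟨t, rfl⟩; exact (h.pos t).le⟩⟩

/-- Two finite limits `L` and `l` of `ξ` at `±∞` would satisfy `L * l = 1 + L = 1 + l`. -/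
theorem tendsto_atTop (h : IsSolution ξ) : Tendsto ξ atTop atTop := by
  refine (tendsto_atTop_of_monotone h.strictMono.monotone).resolve_right ?_
  rintro ⟨L, hL⟩
  obtain ⟨l, hl⟩ := h.exists_tendsto_atBot
  have e1 : L * l = 1 + L := by
    refine tendsto_nhds_unique ((hL.comp tendsto_goldenRatio_mul_atTop).mul
      (hl.comp tendsto_neg_atTop_atBot)) ((hL.const_add 1).congr fun t => ?_)
    exact (h.equation t).symm
  have e2 : l * L = 1 + l := by
    refine tendsto_nhds_unique ((hl.comp (tendsto_id.const_mul_atBot goldenRatio_pos)).mul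
      (hL.comp tendsto_neg_atBot_atTop)) ((hl.const_add 1).congr fun t => ?_)
    exact (h.equation t).symm
  have h1 : ξ 1 ≤ L := h.strictMono.monotone.ge_of_tendsto hL 1
  have h2 : l ≤ ξ 0 := h.strictMono.monotone.le_of_tendsto hl 0
  have h3 := h.strictMono zero_lt_one
  linarith

theorem tendsto_atBot (h : IsSolution ξ) : Tendsto ξ atBot (𝓝 0) := by
  obtain ⟨l, hl⟩ := h.exists_tendsto_atBot
  have h1 : Tendsto (fun t => ξ (goldenRatio * t)) atBot (𝓝 0) := by
    refine ((hl.const_add 1).div_atTop (h.tendsto_atTop.comp tendsto_neg_atBot_atTop)).congr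
      fun t => ?_
    rw [← h.equation t]
    exact mul_div_cancel_right₀ _ (h.pos _).ne'
  have h2 := hl.comp (tendsto_id.const_mul_atBot goldenRatio_pos)
  rwa [tendsto_nhds_unique h2 h1] at hl

theorem exists_eq (h : IsSolution ξ) {c : ℝ} (hc : 0 < c) : ∃ t, ξ t = c := by
  obtain ⟨a, ha⟩ := (h.tendsto_atBot.eventually (gt_mem_nhds hc)).exists
  obtain ⟨b, hb⟩ := (h.tendsto_atTop.eventually_ge_atTop c).exists
  exact mem_range_of_exists_le_of_exists_ge h.contDiff.continuous ⟨a, ha.le⟩ ⟨b, hb⟩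

theorem mul_neg_scaled (h : IsSolution ξ) (t : ℝ) :
    ξ (goldenRatio * t) * ξ (-(goldenRatio * t)) =
      1 + (1 + (ξ t + ξ (-t))) / (ξ t * ξ (-t)) := by
  have e1 := h.equation t
  have e2 := h.equation (-t)
  rw [neg_neg, mul_neg] at e2
  have p1 := h.pos t
  have p2 := h.pos (-t)
  generalize ξ (goldenRatio * t) = a at *
  generalize ξ (-(goldenRatio * t)) = b at *
  field_simp
  linear_combination b * ξ t * e1 + (1 + ξ t) * e2

theorem add_neg_scaled (h : IsSolution ξ) (t : ℝ) :
    ξ (goldenRatio * t) + ξ (-(goldenRatio * t)) =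
      (ξ t + ξ (-t)) * (ξ (goldenRatio * t) * ξ (-(goldenRatio * t)) - 1) - 2 := by
  rw [h.mul_neg_scaled]
  have e1 := h.equation t
  have e2 := h.equation (-t)
  rw [neg_neg, mul_neg] at e2
  have p1 := h.pos t
  have p2 := h.pos (-t)
  generalize ξ (goldenRatio * t) = a at *
  generalize ξ (-(goldenRatio * t)) = b at *
  field_simp
  linear_combination ξ t * e1 + ξ (-t) * e2

/-- With `A = ξ t + ξ (-t)` and `Q = ξ (φ t) * ξ (-φ t) - 1`, passing from `t` to `φ t` turns
`(A, Q)` into `(A * Q - 2, (A * Q - 1) / (1 + Q))`, which is increasing in both variables; so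
monotonicity of the pair spreads from a neighbourhood of `0` to the half-line. -/
theorem add_neg_lt (h : IsSolution ξ) {s t : ℝ} (hs : 0 ≤ s) (hst : s < t) :
    ξ s + ξ (-s) < ξ t + ξ (-t) := by
  have hg := goldenRatio_pos
  have hb := goldenRatio_bounds
  have d1 := h.hasDerivAt_deriv_zero
  have dn : HasDerivAt (fun t => deriv ξ (-t)) (2 / 3 * -1) 0 :=
    HasDerivAt.comp (h₂ := deriv ξ) (h := fun t => -t) 0 (by simpa using d1)
      (_root_.hasDerivAt_neg 0)
  have d0 : HasDerivAt (fun t => ξ (-t)) (-1) 0 := by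
    simpa [h.deriv_zero] using h.hasDerivAt_neg 0
  -- Near `0` both even functions are convex: `A` has second derivative `4 / 3` at `0`, and
  -- `t ↦ ξ t * ξ (-t)` has `4 * φ / 3 - 2`, which is positive since `φ > 3 / 2`.
  obtain ⟨ε₁, hε₁, hA⟩ := exists_strictMonoOn_of_second_deriv_pos
    (f := ξ + fun t => ξ (-t)) (f' := deriv ξ + fun t => -deriv ξ (-t))
    (fun t => (h.hasDerivAt t).add (h.hasDerivAt_neg t)) (by simp) (d1.add dn.neg) (by norm_num)
  obtain ⟨ε₂, hε₂, hP⟩ := exists_strictMonoOn_of_second_deriv_pos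
    (f := ξ * fun t => ξ (-t))
    (f' := (deriv ξ * fun t => ξ (-t)) + (ξ * fun t => -deriv ξ (-t)))
    (fun t => (h.hasDerivAt t).mul (h.hasDerivAt_neg t)) (by simp; ring)
    ((d1.mul d0).add (h.hasDerivAt_zero.mul dn.neg)) (by
      simp only [neg_zero, h.zero, h.deriv_zero]; linarith)
  have key := scaling_induction (p := fun t => ∀ s, 0 ≤ s → s < t →
      ξ s + ξ (-s) < ξ t + ξ (-t) ∧
      ξ (goldenRatio * s) * ξ (-(goldenRatio * s)) <
        ξ (goldenRatio * t) * ξ (-(goldenRatio * t))) ?_ ?_ t s hs hst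
  · exact key.1
  · have hc : ContinuousAt (fun t : ℝ => goldenRatio * t) 0 := by fun_prop
    filter_upwards [gt_mem_nhds hε₁, hc.eventually (gt_mem_nhds (by simpa using hε₂))]
      with t ht1 ht2 s hs hst
    have hst' := mul_lt_mul_of_pos_left hst hg
    refine ⟨hA ⟨hs, (hst.trans ht1).le⟩ ⟨(hs.trans_lt hst).le, ht1.le⟩ hst,
      hP ⟨by positivity, (hst'.trans ht2).le⟩ ⟨?_, ht2.le⟩ hst'⟩
    exact mul_nonneg hg.le (hs.trans_lt hst).le
  · intro t ht _ s hs hst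
    obtain ⟨s, rfl⟩ : ∃ s', s = goldenRatio * s' := ⟨s / goldenRatio, by field_simp⟩
    have hs' : 0 ≤ s := (mul_nonneg_iff_of_pos_left hg).1 hs
    have hst' : s < t := (mul_lt_mul_iff_right₀ hg).1 hst
    obtain ⟨hA, hQ⟩ := ht s hs' hst'
    have a1 := h.add_neg_scaled s
    have a2 := h.add_neg_scaled t
    have m1 := h.mul_neg_scaled (goldenRatio * s)
    have m2 := h.mul_neg_scaled (goldenRatio * t)
    have q1 := h.mul_neg_scaled s
    have hA1 := add_pos (h.pos s) (h.pos (-s))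
    have hQ1 : 0 < ξ (goldenRatio * s) * ξ (-(goldenRatio * s)) - 1 := by
      rw [q1, add_sub_cancel_left]
      have := h.pos s
      have := h.pos (-s)
      positivity
    rw [a1] at m1
    rw [a2] at m2
    rw [a1, a2, m1, m2]
    generalize ξ (goldenRatio * s) * ξ (-(goldenRatio * s)) = P1 at *
    generalize ξ (goldenRatio * t) * ξ (-(goldenRatio * t)) = P2 at *
    generalize ξ s + ξ (-s) = A1 at *
    generalize ξ t + ξ (-t) = A2 at *
    refine ⟨by nlinarith, ?_⟩
    rw [add_lt_add_iff_left, div_lt_div_iff₀ (by linarith) (by linarith)]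
    have e : (1 + (A2 * (P2 - 1) - 2)) * P1 - (1 + (A1 * (P1 - 1) - 2)) * P2 =
      (A2 - A1) * ((P1 - 1) * P2) + (1 + A2) * (P2 - P1) := by ring
    have : 0 < (A2 - A1) * ((P1 - 1) * P2) :=
      mul_pos (by linarith) (mul_pos hQ1 (by linarith))
    have : 0 < (1 + A2) * (P2 - P1) := mul_pos (by linarith) (by linarith)
    linarith

end IsSolution

/-! ### Comparable backward orbits -/

theorem inverse_step_antitone {a b a' b' x y x' y' : ℝ} (ha : 0 < a) (hb : 0 < b)
    (hx : 0 < x) (hx' : 0 < x') (h1 : a * x = 1 + y) (h2 : b * y = 1 + x)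
    (h1' : a' * x' = 1 + y') (h2' : b' * y' = 1 + x') (haa : a < a') (hbb : b < b') :
    x' < x := by
  have e : x * (a * b - 1) = 1 + b := by linear_combination b * h1 + h2
  have e' : x' * (a' * b' - 1) = 1 + b' := by linear_combination b' * h1' + h2'
  have p : 0 < a * b - 1 := (mul_pos_iff_of_pos_left hx).1 (by linarith)
  have p' : 0 < a' * b' - 1 := (mul_pos_iff_of_pos_left hx').1 (by linarith)
  rw [eq_div_of_mul_eq p.ne' e, eq_div_of_mul_eq p'.ne' e', div_lt_div_iff₀ p' p]
  have q1 : 0 < (b * b' + b') * (a' - a) := mul_pos (by nlinarith) (by linarith)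
  have q2 : 0 < (a + 1) * (b' - b) := mul_pos (by linarith) (by linarith)
  linarith

/-- Two backward orbits of `(a, b) ↦ ((1 + b) / a, (1 + a) / b)` with strictly comparable initial
points have no common limit: the inverse map reverses the order, so the orbits stay comparable,
and the ratio of the larger product `a * b` to the smaller one does not decrease. -/
theorem not_comparable_of_tendsto {a b a' b' : ℕ → ℝ} {p q : ℝ} (hp : 0 < p) (hq : 0 < q)
    (ha : ∀ n, 0 < a n) (hb : ∀ n, 0 < b n) (ha' : ∀ n, 0 < a' n) (hb' : ∀ n, 0 < b' n)
    (h1 : ∀ n, a n * a (n + 1) = 1 + b (n + 1)) (h2 : ∀ n, b n * b (n + 1) = 1 + a (n + 1))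
    (h1' : ∀ n, a' n * a' (n + 1) = 1 + b' (n + 1))
    (h2' : ∀ n, b' n * b' (n + 1) = 1 + a' (n + 1))
    (la : Tendsto a atTop (𝓝 p)) (lb : Tendsto b atTop (𝓝 q))
    (la' : Tendsto a' atTop (𝓝 p)) (lb' : Tendsto b' atTop (𝓝 q)) :
    ¬ (a 0 < a' 0 ∧ b 0 < b' 0) := by
  rintro ⟨h0a, h0b⟩
  have hM : 0 < a 0 * b 0 := mul_pos (ha 0) (hb 0)
  set r := (a' 0 * b' 0) / (a 0 * b 0) with hr
  have hr1 : 1 < r := by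
    rw [hr, one_lt_div hM]
    exact mul_lt_mul'' h0a h0b (ha 0).le (hb 0).le
  have step : ∀ {s t u v x y z w : ℝ}, 0 < s * t → 0 < u * v → 0 < x * y → 0 < z * w →
      0 < x → 0 < y → s * x = 1 + y → t * y = 1 + x → u * z = 1 + w → v * w = 1 + z →
      x < z → y < w → r * (u * v) ≤ s * t → r * (x * y) ≤ z * w := by
    intro s t u v x y z w hst huv hxy hzw hx hy e1 e2 e3 e4 hxz hyw hle
    have k1 : (s * t) * (x * y) ≤ (u * v) * (z * w) := by
      have e5 : (s * t) * (x * y) = (1 + y) * (1 + x) := by rw [← e1, ← e2]; ring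
      have e6 : (u * v) * (z * w) = (1 + w) * (1 + z) := by rw [← e3, ← e4]; ring
      rw [e5, e6]
      exact mul_le_mul (by linarith) (by linarith) (by linarith) (by linarith)
    have k2 := mul_le_mul_of_nonneg_right hle hxy.le
    refine le_of_mul_le_mul_left ?_ huv
    linarith
  have main : ∀ n, (a n < a' n ∧ b n < b' n ∧ r * (a n * b n) ≤ a' n * b' n) ∨
      (a' n < a n ∧ b' n < b n ∧ r * (a' n * b' n) ≤ a n * b n) := by
    intro n
    have pos := fun n => mul_pos (ha n) (hb n)
    have pos' := fun n => mul_pos (ha' n) (hb' n)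
    induction n with
    | zero => exact Or.inl ⟨h0a, h0b, (div_mul_cancel₀ _ hM.ne').le⟩
    | succ n ih =>
      rcases ih with ⟨i1, i2, i3⟩ | ⟨i1, i2, i3⟩
      · have j1 := inverse_step_antitone (ha n) (hb n) (ha _) (ha' _) (h1 n) (h2 n) (h1' n)
          (h2' n) i1 i2
        have j2 := inverse_step_antitone (hb n) (ha n) (hb _) (hb' _) (h2 n) (h1 n) (h2' n)
          (h1' n) i2 i1
        exact Or.inr ⟨j1, j2, step (pos' n) (pos n) (pos' _) (pos _) (ha' _) (hb' _) (h1' n)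
          (h2' n) (h1 n) (h2 n) j1 j2 i3⟩
      · have j1 := inverse_step_antitone (ha' n) (hb' n) (ha' _) (ha _) (h1' n) (h2' n) (h1 n)
          (h2 n) i1 i2
        have j2 := inverse_step_antitone (hb' n) (ha' n) (hb' _) (hb _) (h2' n) (h1' n) (h2 n)
          (h1 n) i2 i1
        exact Or.inl ⟨j1, j2, step (pos n) (pos' n) (pos _) (pos' _) (ha _) (hb _) (h1 n)
          (h2 n) (h1' n) (h2' n) j1 j2 i3⟩
  have hle : ∀ n, r * min (a n * b n) (a' n * b' n) ≤ max (a n * b n) (a' n * b' n) := by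
    intro n
    have hr0 : 0 ≤ r := by linarith
    rcases main n with ⟨-, -, h⟩ | ⟨-, -, h⟩
    · exact ((mul_le_mul_of_nonneg_left (min_le_left _ _) hr0).trans h).trans (le_max_right _ _)
    · exact ((mul_le_mul_of_nonneg_left (min_le_right _ _) hr0).trans h).trans (le_max_left _ _)
  have l1 := la.mul lb
  have l2 := la'.mul lb'
  have := le_of_tendsto_of_tendsto' ((l1.min l2).const_mul r) (l1.max l2) hle
  rw [min_self, max_self] at this
  nlinarith [mul_pos hp hq]

/-! ### The unstable manifold in the original coordinates -/

theorem xStar_eq : RSFF.xStar = 1 / (1 + goldenRatio) := by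
  have h5 : √5 ^ 2 = 5 := sq_sqrt (by norm_num)
  have hg := goldenRatio_pos
  rw [eq_div_iff (by linarith)]
  simp only [RSFF.xStar, goldenRatio]
  linear_combination -h5 / 4

/-- In the coordinates `1 / x - 1`, `1 / y - 1` the map `F` becomes
`(a, b) ↦ ((1 + b) / a, (1 + a) / b)`. -/
theorem F_inv_one_add {a b : ℝ} (ha : 0 < a) (hb : 0 < b) :
    RSFF.F (1 / (1 + a), 1 / (1 + b)) = (1 / (1 + (1 + b) / a), 1 / (1 + (1 + a) / b)) := by
  have h : 1 / (1 + a) + 1 / (1 + b) - 1 / (1 + a) * (1 / (1 + b)) =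
      (1 + a + b) / ((1 + a) * (1 + b)) := by field_simp; ring
  simp only [RSFF.F, h]
  ext <;> simp only <;> field_simp <;> ring

theorem mem_X_inv_one_add {a b : ℝ} (ha : 0 < a) (hb : 0 < b) :
    (1 / (1 + a), 1 / (1 + b)) ∈ RSFF.X := by
  have h1 : 0 < 1 / (1 + a) := by positivity
  have h2 : 0 < 1 / (1 + b) := by positivity
  have h3 : 1 / (1 + a) < 1 := by rw [div_lt_one (by linarith)]; linarith
  have h4 : 1 / (1 + b) < 1 := by rw [div_lt_one (by linarith)]; linarith
  refine ⟨⟨⟨h1.le, h3.le⟩, h2.le, h4.le⟩, ?_⟩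
  simp only [Set.mem_insert_iff, Set.mem_singleton_iff, Prod.mk.injEq, not_or, not_and]
  exact ⟨fun h => absurd h h1.ne', fun h => absurd h h3.ne⟩

/-- The point with parameter `t` on the unstable curve, in the original coordinates. -/
noncomputable def curve (ξ : ℝ → ℝ) (t : ℝ) : ℝ × ℝ := (1 / (1 + ξ t), 1 / (1 + ξ (-t)))

namespace IsSolution

variable {ξ : ℝ → ℝ}

theorem scaled_eq_div (h : IsSolution ξ) (t : ℝ) :
    ξ (goldenRatio * t) = (1 + ξ t) / ξ (-t) := by
  rw [← h.equation t, mul_div_cancel_right₀ _ (h.pos _).ne']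

theorem neg_scaled_eq_div (h : IsSolution ξ) (t : ℝ) :
    ξ (-(goldenRatio * t)) = (1 + ξ (-t)) / ξ t := by
  rw [← mul_neg, h.scaled_eq_div, neg_neg]

theorem F_curve (h : IsSolution ξ) (t : ℝ) :
    RSFF.F (curve ξ t) = curve ξ (-(goldenRatio * t)) := by
  rw [curve, curve, neg_neg, F_inv_one_add (h.pos _) (h.pos _), h.neg_scaled_eq_div,
    h.scaled_eq_div]

theorem tendsto_backward (h : IsSolution ξ) (t : ℝ) :
    Tendsto (fun n : ℕ => ξ ((-goldenRatio⁻¹) ^ n * t)) atTop (𝓝 goldenRatio) := by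
  have h1 : Tendsto (fun n : ℕ => (-goldenRatio⁻¹) ^ n * t) atTop (𝓝 0) := by
    rw [← zero_mul t]
    refine (tendsto_pow_atTop_nhds_zero_of_abs_lt_one ?_).mul_const t
    rw [abs_neg, abs_of_pos (inv_pos.2 goldenRatio_pos)]
    exact inv_lt_one_of_one_lt₀ one_lt_goldenRatio
  have h2 := (h.contDiff.continuous.tendsto 0).comp h1
  rwa [h.zero] at h2

theorem goldenRatio_mul_backward (t : ℝ) (n : ℕ) :
    goldenRatio * ((-goldenRatio⁻¹) ^ (n + 1) * t) = -((-goldenRatio⁻¹) ^ n * t) := by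
  have := goldenRatio_ne_zero
  calc goldenRatio * ((-goldenRatio⁻¹) ^ (n + 1) * t)
      = -((goldenRatio * goldenRatio⁻¹) * ((-goldenRatio⁻¹) ^ n * t)) := by ring
    _ = _ := by rw [mul_inv_cancel₀ this, one_mul]

theorem curve_mem_unstableManifold (h : IsSolution ξ) (t : ℝ) :
    curve ξ t ∈ RSFF.unstableManifold RSFF.F RSFF.X RSFF.pStar := by
  refine ⟨fun n => curve ξ ((-goldenRatio⁻¹) ^ n * t), by simp,
    fun n => mem_X_inv_one_add (h.pos _) (h.pos _), fun n => ?_, ?_⟩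
  · rw [h.F_curve, goldenRatio_mul_backward, neg_neg]
  · have hg := goldenRatio_pos
    have h1 := h.tendsto_backward t
    have h2 := h.tendsto_backward (-t)
    simp only [mul_neg] at h2
    rw [RSFF.pStar, xStar_eq]
    exact (tendsto_const_nhds.div (h1.const_add 1) (by linarith)).prodMk_nhds
      (tendsto_const_nhds.div (h2.const_add 1) (by linarith))

/-- A backward orbit of positive points converging to the fixed point starts on the curve:
otherwise its initial point would be strictly comparable to some point of the curve. -/
theorem exists_param_of_backward (h : IsSolution ξ) {a b : ℕ → ℝ}
    (ha : ∀ n, 0 < a n) (hb : ∀ n, 0 < b n)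
    (h1 : ∀ n, a n * a (n + 1) = 1 + b (n + 1)) (h2 : ∀ n, b n * b (n + 1) = 1 + a (n + 1))
    (la : Tendsto a atTop (𝓝 goldenRatio)) (lb : Tendsto b atTop (𝓝 goldenRatio)) :
    ∃ t, a 0 = ξ t ∧ b 0 = ξ (-t) := by
  obtain ⟨t₁, ht₁⟩ := h.exists_eq (ha 0)
  obtain ⟨t₂, ht₂⟩ := h.exists_eq (hb 0)
  have hg := goldenRatio_pos
  -- The midpoint of `t₁` and `-t₂`: both coordinates of its curve point then differ from
  -- `(ξ t₁, ξ t₂)` in the same direction.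
  set t := (t₁ - t₂) / 2 with ht
  have e1 : ∀ n, ξ ((-goldenRatio⁻¹) ^ n * t) * ξ ((-goldenRatio⁻¹) ^ (n + 1) * t) =
      1 + ξ ((-goldenRatio⁻¹) ^ (n + 1) * -t) := by
    intro n
    have := h.equation (-((-goldenRatio⁻¹) ^ (n + 1) * t))
    rw [mul_neg, goldenRatio_mul_backward, neg_neg, neg_neg] at this
    rw [this, mul_neg]
  have e2 : ∀ n, ξ ((-goldenRatio⁻¹) ^ n * -t) * ξ ((-goldenRatio⁻¹) ^ (n + 1) * -t) =
      1 + ξ ((-goldenRatio⁻¹) ^ (n + 1) * t) := by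
    intro n
    have := h.equation ((-goldenRatio⁻¹) ^ (n + 1) * t)
    rw [goldenRatio_mul_backward] at this
    rw [← this, mul_neg, mul_neg]
  have l1 := h.tendsto_backward t
  have l2 := h.tendsto_backward (-t)
  rcases lt_trichotomy t₁ (-t₂) with hlt | heq | hgt
  · refine absurd ?_ (not_comparable_of_tendsto hg hg ha hb (fun n => h.pos _)
      (fun n => h.pos _) h1 h2 e1 e2 la lb l1 l2)
    rw [← ht₁, ← ht₂, pow_zero, one_mul, one_mul]
    exact ⟨h.strictMono (by linarith), h.strictMono (by linarith)⟩
  · exact ⟨t₁, ht₁.symm, by rw [heq, neg_neg, ht₂]⟩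
  · refine absurd ?_ (not_comparable_of_tendsto hg hg (fun n => h.pos _)
      (fun n => h.pos _) ha hb e1 e2 h1 h2 l1 l2 la lb)
    rw [← ht₁, ← ht₂, pow_zero, one_mul, one_mul]
    exact ⟨h.strictMono (by linarith), h.strictMono (by linarith)⟩

theorem unstableManifold_eq_range_curve (h : IsSolution ξ) :
    RSFF.unstableManifold RSFF.F RSFF.X RSFF.pStar = Set.range (curve ξ) := by
  refine Set.Subset.antisymm ?_ (Set.range_subset_iff.2 h.curve_mem_unstableManifold)
  rintro q ⟨s, rfl, -, hF, hlim⟩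
  have hg := goldenRatio_pos
  -- An orbit in the open square is one with positive coordinates `1 / x - 1`, `1 / y - 1`.
  let O : Set (ℝ × ℝ) := Set.Ioo 0 1 ×ˢ Set.Ioo 0 1
  have hO : ∀ z ∈ O, 0 < 1 / z.1 - 1 ∧ 0 < 1 / z.2 - 1 ∧
      z = (1 / (1 + (1 / z.1 - 1)), 1 / (1 + (1 / z.2 - 1))) := by
    rintro ⟨x, y⟩ ⟨⟨h1, h2⟩, h3, h4⟩
    exact ⟨sub_pos.2 ((one_lt_div h1).2 h2), sub_pos.2 ((one_lt_div h3).2 h4), by simp⟩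
  have hO' : ∀ {a b : ℝ}, 0 < a → 0 < b → (1 / (1 + a), 1 / (1 + b)) ∈ O := by
    intro a b ha hb
    exact ⟨⟨by positivity, by rw [div_lt_one (by linarith)]; linarith⟩,
      by positivity, by rw [div_lt_one (by linarith)]; linarith⟩
  have hFO : ∀ z ∈ O, RSFF.F z ∈ O := by
    intro z hz
    obtain ⟨h1, h2, h3⟩ := hO z hz
    rw [h3, F_inv_one_add h1 h2]
    exact hO' (by positivity) (by positivity)
  have hOopen : IsOpen O := isOpen_Ioo.prod isOpen_Ioo
  have hpO : RSFF.pStar ∈ O := by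
    rw [RSFF.pStar, xStar_eq]; exact hO' hg hg
  obtain ⟨N, hN⟩ := eventually_atTop.1 (hlim.eventually (hOopen.mem_nhds hpO))
  -- `F` preserves the open square, so the orbit lies in it from its far past onwards.
  have down : ∀ k n, s (n + k) ∈ O → s n ∈ O := by
    intro k
    induction k with
    | zero => exact fun n hn => hn
    | succ k ih =>
      intro n hn
      refine ih n ?_
      rw [← hF (n + k)]
      exact hFO _ hn
  have hsO : ∀ n, s n ∈ O := fun n => down N n (hN _ (Nat.le_add_left _ _))
  have hrec : ∀ n, (1 / (s n).1 - 1) * (1 / (s (n + 1)).1 - 1) = 1 + (1 / (s (n + 1)).2 - 1) ∧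
      (1 / (s n).2 - 1) * (1 / (s (n + 1)).2 - 1) = 1 + (1 / (s (n + 1)).1 - 1) := by
    intro n
    obtain ⟨h1, h2, h3⟩ := hO _ (hsO (n + 1))
    have e := hF n
    rw [h3, F_inv_one_add h1 h2] at e
    rw [← e]
    simp only [one_div_one_div, add_sub_cancel_left]
    exact ⟨div_mul_cancel₀ _ h1.ne', div_mul_cancel₀ _ h2.ne'⟩
  have hx : RSFF.xStar ≠ 0 := by rw [xStar_eq]; positivity
  have hlx : 1 / RSFF.xStar - 1 = goldenRatio := by rw [xStar_eq]; simp
  have l1 : Tendsto (fun n => 1 / (s n).1 - 1) atTop (𝓝 goldenRatio) := by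
    rw [← hlx]
    exact (tendsto_const_nhds.div ((continuous_fst.tendsto _).comp hlim) hx).sub_const 1
  have l2 : Tendsto (fun n => 1 / (s n).2 - 1) atTop (𝓝 goldenRatio) := by
    rw [← hlx]
    exact (tendsto_const_nhds.div ((continuous_snd.tendsto _).comp hlim) hx).sub_const 1
  obtain ⟨t, ht1, ht2⟩ := h.exists_param_of_backward (fun n => (hO _ (hsO n)).1)
    (fun n => (hO _ (hsO n)).2.1) (fun n => (hrec n).1) (fun n => (hrec n).2) l1 l2
  exact ⟨t, by rw [(hO _ (hsO 0)).2.2, ht1, ht2, curve]⟩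

end IsSolution

/-! ### The coordinates `u` and `v` -/

theorem TInv_T (p : ℝ × ℝ) : RSFF.TInv (RSFF.T p) = p := by
  have h2 : √2 * √2 = 2 := mul_self_sqrt (by norm_num)
  have h0 : √2 ≠ 0 := by positivity
  ext <;> simp only [RSFF.T, RSFF.TInv] <;> field_simp <;> rw [pow_two, h2] <;> ring

theorem T_pStar : RSFF.T RSFF.pStar = (0, 0) := by
  ext <;> simp [RSFF.T, RSFF.pStar]; ring

theorem continuous_T : Continuous RSFF.T := by unfold RSFF.T; fun_prop

theorem continuous_TInv : Continuous RSFF.TInv := by unfold RSFF.TInv; fun_prop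

/-- Conjugation by `T` carries the unstable manifold of `F` to that of `FTilde`. -/
theorem unstableManifold_FTilde :
    RSFF.unstableManifold RSFF.FTilde (RSFF.T '' RSFF.X) (0, 0) =
      RSFF.T '' RSFF.unstableManifold RSFF.F RSFF.X RSFF.pStar := by
  ext w
  constructor
  · rintro ⟨s, rfl, hX, hF, hlim⟩
    choose r hr hrs using hX
    refine ⟨r 0, ⟨r, rfl, hr, fun n => ?_, ?_⟩, hrs 0⟩
    · have := hF n
      rw [← hrs, ← hrs, RSFF.FTilde, Function.comp, Function.comp, TInv_T] at this
      have h := congrArg RSFF.TInv this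
      rwa [TInv_T, TInv_T] at h
    · have h := (continuous_TInv.tendsto _).comp hlim
      rw [← T_pStar, TInv_T] at h
      refine h.congr fun n => ?_
      rw [Function.comp, ← hrs, TInv_T]
  · rintro ⟨q, ⟨s, rfl, hX, hF, hlim⟩, rfl⟩
    refine ⟨fun n => RSFF.T (s n), rfl, fun n => ⟨_, hX n, rfl⟩, fun n => ?_, ?_⟩
    · rw [RSFF.FTilde, Function.comp, Function.comp, TInv_T, hF]
    · rw [← T_pStar]
      exact (continuous_T.tendsto _).comp hlim

/-- The `u`-coordinate along the unstable curve. -/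
noncomputable def uCoord (ξ : ℝ → ℝ) (t : ℝ) : ℝ := (RSFF.T (curve ξ t)).1

/-- The `v`-coordinate along the unstable curve. -/
noncomputable def vCoord (ξ : ℝ → ℝ) (t : ℝ) : ℝ := (RSFF.T (curve ξ t)).2

/-- `S` is twice the denominator of `F`. -/
theorem S_T (x y : ℝ) :
    RSFF.S (RSFF.T (x, y)).1 (RSFF.T (x, y)).2 = 2 * (x + y - x * y) := by
  have h2 : √2 ^ 2 = 2 := sq_sqrt (by norm_num)
  have h0 : √2 ≠ 0 := by positivity
  simp only [RSFF.S, RSFF.T]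
  field_simp
  rw [h2]
  ring

theorem T_F_snd {x y : ℝ} :
    (RSFF.T (RSFF.F (x, y))).2 =
      -2 * (RSFF.T (x, y)).2 / RSFF.S (RSFF.T (x, y)).1 (RSFF.T (x, y)).2 := by
  rw [S_T]
  simp only [RSFF.T, RSFF.F]
  rcases eq_or_ne (x + y - x * y) 0 with h | h
  · simp [h]
  · field_simp
    ring

/-- The first component of `T ∘ F`, solved for the linear term in `u`. -/
theorem T_F_fst {x y : ℝ} (hd : x + y - x * y ≠ 0) :
    (RSFF.T (x, y)).1 = RSFF.kappa * ((1 - RSFF.xStar) *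
      ((RSFF.T (x, y)).1 ^ 2 - (RSFF.T (x, y)).2 ^ 2) +
        RSFF.S (RSFF.T (x, y)).1 (RSFF.T (x, y)).2 / √2 * (RSFF.T (RSFF.F (x, y))).1) := by
  have h2 : √2 ^ 2 = 2 := sq_sqrt (by norm_num)
  have h0 : √2 ≠ 0 := by positivity
  have h5 : √5 ^ 2 = 5 := sq_sqrt (by norm_num)
  have hx : RSFF.xStar ^ 2 = 3 * RSFF.xStar - 1 := by
    simp only [RSFF.xStar]; linear_combination h5 / 4
  have hk : 1 - 4 * RSFF.xStar + 2 * RSFF.xStar ^ 2 ≠ 0 := by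
    rw [hx]
    simp only [RSFF.xStar]
    intro h
    have : √5 = 2 := by linarith
    rw [this] at h5; norm_num at h5
  have e : RSFF.S (RSFF.T (x, y)).1 (RSFF.T (x, y)).2 / √2 * (RSFF.T (RSFF.F (x, y))).1 =
      x + y - 2 * (x * y) - 2 * RSFF.xStar * (x + y - x * y) := by
    rw [S_T]
    simp only [RSFF.T, RSFF.F]
    field_simp
    rw [h2]
    ring
  rw [e, RSFF.kappa, one_div, ← div_eq_inv_mul, eq_div_iff (mul_ne_zero h0 hk)]
  simp only [RSFF.T]
  field_simp
  rw [h2]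
  linear_combination (-4 * RSFF.xStar) * hx

namespace IsSolution

variable {ξ : ℝ → ℝ}

theorem T_curve (t : ℝ) : RSFF.T (curve ξ t) = (uCoord ξ t, vCoord ξ t) := rfl

theorem uCoord_neg (t : ℝ) : uCoord ξ (-t) = uCoord ξ t := by
  simp only [uCoord, RSFF.T, curve, neg_neg]; ring

theorem vCoord_neg (t : ℝ) : vCoord ξ (-t) = -vCoord ξ t := by
  simp only [vCoord, RSFF.T, curve, neg_neg]; ring

theorem vCoord_zero : vCoord ξ 0 = 0 := by simp [vCoord, RSFF.T, curve]

theorem uCoord_zero (h : IsSolution ξ) : uCoord ξ 0 = 0 := by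
  simp only [uCoord, RSFF.T, curve, neg_zero, h.zero, xStar_eq]; ring

theorem contDiff_coords (h : IsSolution ξ) :
    ContDiff ℝ ((⊤ : ℕ∞) : WithTop ℕ∞) (uCoord ξ) ∧
      ContDiff ℝ ((⊤ : ℕ∞) : WithTop ℕ∞) (vCoord ξ) := by
  have h1 : ContDiff ℝ ((⊤ : ℕ∞) : WithTop ℕ∞) fun t => 1 / (1 + ξ t) :=
    contDiff_const.div (contDiff_const.add h.contDiff) fun t => by linarith [h.pos t]
  have h2 : ContDiff ℝ ((⊤ : ℕ∞) : WithTop ℕ∞) fun t => 1 / (1 + ξ (-t)) :=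
    h1.comp contDiff_neg
  exact ⟨((h1.add h2).sub contDiff_const).div_const _, (h1.neg.add h2).div_const _⟩

theorem exists_hasDerivAt_vCoord_pos (h : IsSolution ξ) (t : ℝ) :
    ∃ d > 0, HasDerivAt (vCoord ξ) d t := by
  have p1 := h.pos t
  have p2 := h.pos (-t)
  have d1 := ((h.hasDerivAt t).const_add 1).fun_inv (by positivity)
  have d2 := ((h.hasDerivAt_neg t).const_add 1).fun_inv (by positivity)
  have d3 := (d1.fun_neg.fun_add d2).div_const (√2)
  simp only [← one_div] at d3
  refine ⟨_, ?_, d3⟩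
  have q1 := h.deriv_pos t
  have q2 := h.deriv_pos (-t)
  rw [neg_div, neg_neg, neg_neg]
  positivity

theorem strictMono_vCoord (h : IsSolution ξ) : StrictMono (vCoord ξ) := by
  refine strictMono_of_deriv_pos fun t => ?_
  obtain ⟨d, hd, hd'⟩ := h.exists_hasDerivAt_vCoord_pos t
  rwa [hd'.deriv]

theorem tendsto_curve (h : IsSolution ξ) :
    Tendsto (curve ξ) atTop (𝓝 (0, 1)) := by
  have h1 : Tendsto (fun t => 1 / (1 + ξ t)) atTop (𝓝 0) :=
    (tendsto_const_nhds).div_atTop (tendsto_atTop_add_const_left _ _ h.tendsto_atTop)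
  have h2 : Tendsto (fun t => 1 / (1 + ξ (-t))) atTop (𝓝 (1 / (1 + 0))) :=
    tendsto_const_nhds.div ((h.tendsto_atBot.comp tendsto_neg_atTop_atBot).const_add 1)
      (by norm_num)
  rw [add_zero, div_one] at h2
  exact h1.prodMk_nhds h2

theorem tendsto_uCoord (h : IsSolution ξ) :
    Tendsto (uCoord ξ) atTop (𝓝 ((-2 + √5) / √2)) := by
  have h1 := (continuous_fst.tendsto _).comp ((continuous_T.tendsto _).comp h.tendsto_curve)
  have e : (RSFF.T (0, 1)).1 = (-2 + √5) / √2 := by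
    simp only [RSFF.T, RSFF.xStar]; ring
  rwa [e] at h1

theorem tendsto_vCoord (h : IsSolution ξ) : Tendsto (vCoord ξ) atTop (𝓝 (1 / √2)) := by
  have h1 := (continuous_snd.tendsto _).comp ((continuous_T.tendsto _).comp h.tendsto_curve)
  have e : (RSFF.T (0, 1)).2 = 1 / √2 := by simp [RSFF.T]
  rwa [e] at h1

theorem abs_vCoord_lt (h : IsSolution ξ) (t : ℝ) : |vCoord ξ t| < 1 / √2 := by
  have key : ∀ t, vCoord ξ t < 1 / √2 := fun t =>
    (h.strictMono_vCoord (lt_add_one t)).trans_le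
      (h.strictMono_vCoord.monotone.ge_of_tendsto h.tendsto_vCoord _)
  rw [abs_lt]
  have := key (-t)
  rw [vCoord_neg] at this
  exact ⟨by linarith, key t⟩

theorem exists_vCoord_eq (h : IsSolution ξ) {v : ℝ} (hv : |v| < 1 / √2) :
    ∃ t, vCoord ξ t = v := by
  obtain ⟨a, ha⟩ := (h.tendsto_vCoord.eventually (lt_mem_nhds (abs_lt.1 hv).2)).exists
  obtain ⟨b, hb⟩ := (h.tendsto_vCoord.eventually
    (lt_mem_nhds (show -v < 1 / √2 by linarith [(abs_lt.1 hv).1]))).exists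
  exact mem_range_of_exists_le_of_exists_ge h.contDiff_coords.2.continuous
    ⟨-b, by rw [vCoord_neg]; linarith⟩ ⟨a, ha.le⟩

/-- The parameter is a smooth function of `v`. -/
theorem exists_smooth_inverse (h : IsSolution ξ) :
    ∃ τ : ℝ → ℝ, (∀ t, τ (vCoord ξ t) = t) ∧
      ContDiffOn ℝ ((⊤ : ℕ∞) : WithTop ℕ∞) τ (Set.Ioo (-(1 / √2)) (1 / √2)) := by
  choose d hd hd' using h.exists_hasDerivAt_vCoord_pos
  have hstrict : ∀ t, HasStrictDerivAt (vCoord ξ) (d t) t := fun t =>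
    h.contDiff_coords.2.contDiffAt.hasStrictDerivAt' (hd' t) (by simp)
  have hemb : IsOpenEmbedding (vCoord ξ) :=
    .of_continuous_injective_isOpenMap h.contDiff_coords.2.continuous
      h.strictMono_vCoord.injective (isOpenMap_of_hasStrictDerivAt hstrict fun t => (hd t).ne')
  let e := hemb.toOpenPartialHomeomorph
  have he : ∀ t, e.symm (vCoord ξ t) = t := fun t => e.left_inv (Set.mem_univ t)
  refine ⟨e.symm, he, fun v hv => ContDiffAt.contDiffWithinAt ?_⟩
  obtain ⟨t, rfl⟩ := h.exists_vCoord_eq (abs_lt.2 hv)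
  refine e.contDiffAt_symm_deriv (hd t).ne' (e.map_source (Set.mem_univ t)) ?_ ?_
  · rw [he]; exact hd' t
  · exact h.contDiff_coords.2.contDiffAt

theorem uCoord_strictMonoOn (h : IsSolution ξ) : StrictMonoOn (uCoord ξ) (Set.Ici 0) := by
  have hg := goldenRatio_pos
  -- `x + y` at parameter `φ t` equals `1 - 1 / (1 + A)` with `A = ξ t + ξ (-t)`.
  have e : ∀ t, uCoord ξ (goldenRatio * t) =
      (1 - 1 / (1 + (ξ t + ξ (-t))) - 2 * RSFF.xStar) / √2 := by
    intro t
    have p1 := h.pos t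
    have p2 := h.pos (-t)
    simp only [uCoord, RSFF.T, curve, h.scaled_eq_div, h.neg_scaled_eq_div]
    congr 2
    field_simp
    ring
  intro s hs t ht hst
  obtain ⟨s, rfl⟩ : ∃ s', s = goldenRatio * s' := ⟨s / goldenRatio, by field_simp⟩
  obtain ⟨t, rfl⟩ : ∃ s', t = goldenRatio * s' := ⟨t / goldenRatio, by field_simp⟩
  have hs' : 0 ≤ s := (mul_nonneg_iff_of_pos_left hg).1 hs
  have hst' : s < t := (mul_lt_mul_iff_right₀ hg).1 hst
  have p1 := h.pos s
  have p2 := h.pos (-s)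
  have hA := h.add_neg_lt hs' hst'
  rw [e, e]
  have : 1 / (1 + (ξ t + ξ (-t))) < 1 / (1 + (ξ s + ξ (-s))) :=
    one_div_lt_one_div_of_lt (by positivity) (by linarith)
  exact div_lt_div_of_pos_right (by linarith) (by positivity)

end IsSolution

end GoldenCurve

/-! ### The graph function -/

open GoldenCurve in
theorem lemma3p2 :
    ∃ φ : ℝ → ℝ,
      -- the unstable manifold, in the original and in the new coordinates, is the graph of `φ`
      RSFF.T '' RSFF.unstableManifold RSFF.F RSFF.X RSFF.pStar =
          {w : ℝ × ℝ | ∃ v : ℝ, |v| < 1 / √2 ∧ w = (φ v, v)} ∧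
      RSFF.unstableManifold RSFF.FTilde (RSFF.T '' RSFF.X) ((0 : ℝ), (0 : ℝ)) =
          {w : ℝ × ℝ | ∃ v : ℝ, |v| < 1 / √2 ∧ w = (φ v, v)} ∧
      -- smoothness
      ContDiffOn ℝ ((⊤ : ℕ∞) : WithTop ℕ∞) φ (Set.Ioo (-(1 / √2)) (1 / √2)) ∧
      -- (i)
      φ 0 = 0 ∧ HasDerivAt φ 0 0 ∧
      StrictMonoOn φ (Set.Ico 0 (1 / √2)) ∧
      Filter.Tendsto φ (nhdsWithin (1 / √2) (Set.Iio (1 / √2))) (nhds ((-2 + √5) / √2)) ∧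
      -- (ii)
      (∀ v : ℝ, |v| < 1 / √2 → φ (-v) = φ v) ∧
      -- (iii), with the facts that make both sides meaningful
      (∀ v : ℝ, |v| < 1 / √2 →
        0 < RSFF.S (φ v) v ∧ |-2 * v / RSFF.S (φ v) v| < 1 / √2 ∧
        φ v = RSFF.kappa * ((1 - RSFF.xStar) * (φ v ^ 2 - v ^ 2) +
          RSFF.S (φ v) v / √2 * φ (-2 * v / RSFF.S (φ v) v))) := by
  obtain ⟨ξ, h⟩ := exists_isSolution
  obtain ⟨τ, hτ, hsmooth⟩ := h.exists_smooth_inverse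
  have hφ : ∀ t, uCoord ξ (τ (vCoord ξ t)) = uCoord ξ t := fun t => by rw [hτ]
  have hgraph : RSFF.T '' RSFF.unstableManifold RSFF.F RSFF.X RSFF.pStar =
      {w : ℝ × ℝ | ∃ v : ℝ, |v| < 1 / √2 ∧ w = (uCoord ξ (τ v), v)} := by
    rw [h.unstableManifold_eq_range_curve]
    ext w
    constructor
    · rintro ⟨_, ⟨t, rfl⟩, rfl⟩
      exact ⟨vCoord ξ t, h.abs_vCoord_lt t, by rw [hφ, IsSolution.T_curve]⟩
    · rintro ⟨v, hv, rfl⟩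
      obtain ⟨t, rfl⟩ := h.exists_vCoord_eq hv
      exact ⟨_, ⟨t, rfl⟩, by rw [hφ, IsSolution.T_curve]⟩
  have hcd : ContDiffOn ℝ ((⊤ : ℕ∞) : WithTop ℕ∞) (fun v => uCoord ξ (τ v))
      (Set.Ioo (-(1 / √2)) (1 / √2)) := h.contDiff_coords.1.comp_contDiffOn hsmooth
  have heven : ∀ v : ℝ, |v| < 1 / √2 → uCoord ξ (τ (-v)) = uCoord ξ (τ v) := by
    intro v hv
    obtain ⟨t, rfl⟩ := h.exists_vCoord_eq hv
    rw [← IsSolution.vCoord_neg, hφ, hφ, IsSolution.uCoord_neg]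
  have hpos : (0 : ℝ) < 1 / √2 := by positivity
  have hnhds : Set.Ioo (-(1 / √2)) (1 / √2) ∈ 𝓝 (0 : ℝ) := Ioo_mem_nhds (by linarith) hpos
  refine ⟨fun v => uCoord ξ (τ v), hgraph, unstableManifold_FTilde.trans hgraph, hcd, ?_, ?_, ?_,
    ?_, heven, ?_⟩
  · have := hφ 0
    rwa [IsSolution.vCoord_zero, h.uCoord_zero] at this
  · -- The derivative at `0` of an even function equals its own negative.
    have hd := ((hcd.contDiffAt hnhds).differentiableAt (by simp)).hasDerivAt
    have hd' := HasDerivAt.comp (h₂ := fun v => uCoord ξ (τ v)) (h := fun v => -v) 0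
      (by rw [neg_zero]; exact hd) (hasDerivAt_neg 0)
    have hev : ((fun v => uCoord ξ (τ v)) ∘ fun v => -v) =ᶠ[𝓝 0] fun v => uCoord ξ (τ v) := by
      filter_upwards [hnhds] with v hv using heven v (abs_lt.2 hv)
    have := hd.unique (hd'.congr_of_eventuallyEq hev.symm)
    have h0 : deriv (fun v => uCoord ξ (τ v)) 0 = 0 := by linarith
    rwa [h0] at hd
  · intro v hv w hw hvw
    obtain ⟨s, rfl⟩ := h.exists_vCoord_eq (abs_lt.2 ⟨by linarith [hv.1], hv.2⟩)
    obtain ⟨t, rfl⟩ := h.exists_vCoord_eq (abs_lt.2 ⟨by linarith [hw.1], hw.2⟩)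
    have hs : 0 ≤ s := by
      rw [← h.strictMono_vCoord.le_iff_le, IsSolution.vCoord_zero]; exact hv.1
    have hst : s < t := h.strictMono_vCoord.lt_iff_lt.1 hvw
    simp only [hφ]
    exact h.uCoord_strictMonoOn hs (hs.trans hst.le) hst
  · refine h.tendsto_uCoord.comp (tendsto_atTop.2 fun b => ?_)
    have hb := abs_lt.1 (h.abs_vCoord_lt b)
    filter_upwards [Ioo_mem_nhdsLT hb.2] with v hv
    obtain ⟨t, rfl⟩ := h.exists_vCoord_eq (abs_lt.2 ⟨by linarith [hv.1], hv.2⟩)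
    rw [hτ]
    exact (h.strictMono_vCoord.lt_iff_lt.1 hv.1).le
  · intro v hv
    obtain ⟨t, rfl⟩ := h.exists_vCoord_eq hv
    have p1 := h.pos t
    have p2 := h.pos (-t)
    have hd : 0 < 1 / (1 + ξ t) + 1 / (1 + ξ (-t)) - 1 / (1 + ξ t) * (1 / (1 + ξ (-t))) := by
      have : 1 / (1 + ξ t) + 1 / (1 + ξ (-t)) - 1 / (1 + ξ t) * (1 / (1 + ξ (-t))) =
        (1 + ξ t + ξ (-t)) / ((1 + ξ t) * (1 + ξ (-t))) := by field_simp; ring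
      rw [this]; positivity
    have hS : RSFF.S (uCoord ξ t) (vCoord ξ t) = 2 * (1 / (1 + ξ t) + 1 / (1 + ξ (-t)) -
      1 / (1 + ξ t) * (1 / (1 + ξ (-t)))) := S_T _ _
    have hv' : vCoord ξ (-(goldenRatio * t)) =
        -2 * vCoord ξ t / RSFF.S (uCoord ξ t) (vCoord ξ t) := by
      rw [vCoord, ← h.F_curve]; exact T_F_snd
    have hu' : (RSFF.T (RSFF.F (curve ξ t))).1 = uCoord ξ (-(goldenRatio * t)) := by
      rw [h.F_curve]; rfl
    simp only [hφ]
    rw [← hv', hφ, ← hu']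
    exact ⟨by rw [hS]; linarith, h.abs_vCoord_lt _, T_F_fst hd.ne'⟩
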